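/- Let $(A,\mathfrak m)$ be a commutative noetherian local ring, $M$ a finitely generated $A$-module of finite projective dimension, and $\mathfrak p$ a prime ideal of $A$. Let $C$ be a (not necessarily finitely generated) balanced big Cohen--Macaulay module over the local ring $A/\mathfrak p$; that is, every system of parameters of $A/\mathfrak p$ is a regular sequence on $C$ (where a regular sequence $x_1,\dots,x_d$ on $C$ is required to satisfy $C\neq (x_1,\dots,x_d)C$). Then $$\sup\{n\ge 0 : \operatorname{Tor}^A_n(C,M)\neq 0\}\ \le\ \operatorname{depth} A_{\mathfrak p},$$ where the supremum of the empty set is $-\infty$ and $\operatorname{depth} A_{\mathfrak p}$ is the supremum of the lengths of the $A_{\mathfrak p}$-regular sequences contained in the maximal ideal of $A_{\mathfrak p}$. -/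

import Mathlib

open CategoryTheory

universe u

/-- A finite sequence `rs` in a local ring `R` is a system of parameters if it consists of
`dim R` elements and generates an ideal primary to the maximal ideal. -/
def IsSystemOfParameters (R : Type u) [CommRing R] [IsLocalRing R] (rs : List R) : Prop :=
  ((rs.length : ℕ∞) : WithBot ℕ∞) = ringKrullDim R ∧
    (Ideal.ofList rs).radical = IsLocalRing.maximalIdeal R

/-- A (not necessarily finitely generated) module over a local ring is big Cohen-Macaulay if
some system of parameters is a regular sequence on it. -/
def IsBigCohenMacaulay (R : Type u) [CommRing R] [IsLocalRing R]
    (C : Type u) [AddCommGroup C] [Module R C] : Prop :=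
  ∃ rs : List R, IsSystemOfParameters R rs ∧ RingTheory.Sequence.IsRegular C rs

/-- A big Cohen-Macaulay module is balanced if every system of parameters is a regular sequence
on it. -/
structure IsBalancedBigCohenMacaulay (R : Type u) [CommRing R] [IsLocalRing R]
    (C : Type u) [AddCommGroup C] [Module R C] : Prop where
  isBigCohenMacaulay : IsBigCohenMacaulay R C
  isRegular : ∀ rs : List R, IsSystemOfParameters R rs → RingTheory.Sequence.IsRegular C rs

/-- The depth of a local ring: the supremum of the lengths of the regular sequences contained in
its maximal ideal. -/
noncomputable def localRingDepth (R : Type u) [CommRing R] [IsLocalRing R] : ℕ∞ :=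
  ⨆ (rs : List R) (_ : (∀ r ∈ rs, r ∈ IsLocalRing.maximalIdeal R) ∧
    RingTheory.Sequence.IsRegular R rs), (rs.length : ℕ∞)

/-- `sup {n | Torₙ(X, Y) ≠ 0}`, which is `⊥` (that is, `-∞`) if all `Torₙ(X, Y)` vanish. -/
noncomputable def torSup (A : Type u) [CommRing A] (X Y : Type u)
    [AddCommGroup X] [Module A X] [AddCommGroup Y] [Module A Y] : WithBot ℕ∞ :=
  ⨆ (n : ℕ) (_ : ¬ Limits.IsZero
    (((Tor (ModuleCat.{u} A) n).obj (ModuleCat.of A X)).obj (ModuleCat.of A Y))),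
    ((n : ℕ∞) : WithBot ℕ∞)

/-- The quotient of a local ring by a prime ideal is local. -/
instance isLocalRing_quotient_prime (A : Type u) [CommRing A] [IsLocalRing A]
    (p : Ideal A) [p.IsPrime] : IsLocalRing (A ⧸ p) :=
  .of_surjective' (Ideal.Quotient.mk p) Ideal.Quotient.mk_surjective

/-! Let `P` be a projective resolution of `M`, let `s` be the top degree in which `C ⊗ P` has
homology, and let `q` be an associated prime of that homology, say the annihilator of a class `e`.
Since `p` kills `C`, it kills `e`, so `p ≤ q`. The projective dimension of `M` at `q` is then
estimated from both sides.

From below: let `h` be the height of `q / p`. A system of parameters of `A / p` can be chosen to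
start with `h` elements of `q / p`; because `C` is balanced, their lifts are regular on `C`. They
kill `e`, so each one moves a top class with annihilator `q` up one degree
(`exists_homology_of_isWeaklyRegular`). A class with annihilator `q` thus appears in degree `s + h`,
for a quotient of `C`. If `M_q` had projective dimension below `s + h`, some element outside `q`
would kill that class (`exists_smul_tor_eq_zero`).

From above: a maximal regular sequence in `pA_q` has some length `t ≤ depth A_p`. Extending it to
one maximal in `A_q` takes at most `h` more elements, since each strictly enlarges an associated
prime containing `pA_q`. Auslander-Buchsbaum gives projective dimension at most `t + h`
(`exists_hasProjectiveDimensionLE_add`). Hence `s ≤ t`. -/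

/-! ### Regular sequences and the top homology of `X ⊗ P`. -/

section Tor

variable {A : Type u} [CommRing A]

/-- The complex `X ⊗ P`, as a functor of the module `X`. -/
noncomputable def tensorComplex (P : ChainComplex (ModuleCat.{u} A) ℕ) :
    ModuleCat.{u} A ⥤ ChainComplex (ModuleCat.{u} A) ℕ where
  obj X := (((MonoidalCategory.tensoringLeft (ModuleCat.{u} A)).obj X).mapHomologicalComplex _).obj P
  map f := (NatTrans.mapHomologicalComplex
    ((MonoidalCategory.tensoringLeft (ModuleCat.{u} A)).map f) _).app P
  map_id X := by
    ext i : 1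
    simp
  map_comp f g := by
    ext i : 1
    simp

instance (P : ChainComplex (ModuleCat.{u} A) ℕ) : (tensorComplex P).Additive where
  map_add {X Y f g} := by
    ext i : 1
    simp [tensorComplex]
    rfl

lemma tensorComplex_map_smul_id (P : ChainComplex (ModuleCat.{u} A) ℕ) (X : ModuleCat.{u} A)
    (a : A) : (tensorComplex P).map (a • 𝟙 X) = a • 𝟙 _ := by
  ext i : 1
  simp [tensorComplex]
  rfl

lemma homologyMap_smul_id (K : ChainComplex (ModuleCat.{u} A) ℕ) (a : A) (n : ℕ) :
    HomologicalComplex.homologyMap (a • 𝟙 K) n = a • 𝟙 (K.homology n) := by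
  have h := ShortComplex.homologyMap_smul (𝟙 (K.sc n)) a
  rw [ShortComplex.homologyMap_id] at h
  exact h

lemma smul_eq_zero_of_mem_annihilator (P : ChainComplex (ModuleCat.{u} A) ℕ)
    (X : ModuleCat.{u} A) {a : A} (ha : ∀ x : X, a • x = 0) (n : ℕ)
    (e : ((tensorComplex P).obj X).homology n) : a • e = 0 := by
  have h0 : a • 𝟙 X = 0 := by
    ext x
    exact ha x
  have h := homologyMap_smul_id ((tensorComplex P).obj X) a n
  rw [← tensorComplex_map_smul_id, h0] at h
  rw [Functor.map_zero, HomologicalComplex.homologyMap_zero] at h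
  exact (congr($(h).hom e)).symm

lemma tensorComplex_shortExact (P : ChainComplex (ModuleCat.{u} A) ℕ)
    [∀ n, Projective (P.X n)] (S : ShortComplex (ModuleCat.{u} A)) (hS : S.ShortExact) :
    ∃ w, (ShortComplex.mk ((tensorComplex P).map S.f) ((tensorComplex P).map S.g) w).ShortExact := by
  have hf : Function.Injective S.f.hom := (ModuleCat.mono_iff_injective _).1 hS.mono_f
  have hg : Function.Surjective S.g.hom := (ModuleCat.epi_iff_surjective _).1 hS.epi_g
  have hfg : Function.Exact S.f.hom S.g.hom :=
    (ShortComplex.ShortExact.moduleCat_exact_iff_function_exact S).1 hS.exact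
  refine ⟨?_, ?_⟩
  · rw [← Functor.map_comp, S.zero, Functor.map_zero]
  · refine HomologicalComplex.shortExact_of_degreewise_shortExact _ fun i ↦ ?_
    have : Module.Projective A (P.X i) := (IsProjective.iff_projective _).2 inferInstance
    refine { exact := ?_, mono_f := ?_, epi_g := ?_ }
    · rw [ShortComplex.ShortExact.moduleCat_exact_iff_function_exact]
      exact rTensor_exact (P.X i) hfg hg
    · rw [ModuleCat.mono_iff_injective]
      exact Module.Flat.rTensor_preserves_injective_linearMap (M := P.X i) _ hf
    · rw [ModuleCat.epi_iff_surjective]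
      exact LinearMap.rTensor_surjective (P.X i) hg

/-- In the long exact sequence of multiplication by `x` on `X`, the connecting map out of degree `s
+ 1` is injective because `X ⊗ P` has no homology there, and its image is the kernel of `x` in
degree `s`, which contains `e`. Injectivity and linearity preserve the annihilator. -/
lemma exists_homology_quotSMulTop (P : ChainComplex (ModuleCat.{u} A) ℕ)
    [∀ n, Projective (P.X n)] (X : ModuleCat.{u} A) {x : A} (hx : IsSMulRegular X x) {s : ℕ}
    (hs : ∀ i, s < i → Limits.IsZero (((tensorComplex P).obj X).homology i))
    (e : ((tensorComplex P).obj X).homology s) (he : x • e = 0) :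
    (∀ i, s + 1 < i → Limits.IsZero
      (((tensorComplex P).obj (ModuleCat.of A (QuotSMulTop x X))).homology i)) ∧
    ∃ e' : ((tensorComplex P).obj (ModuleCat.of A (QuotSMulTop x X))).homology (s + 1),
      ∀ a : A, a • e' = 0 ↔ a • e = 0 := by
  obtain ⟨w, hS⟩ := tensorComplex_shortExact P _ hx.smulShortComplex_shortExact
  constructor
  · intro i hi
    obtain ⟨j, rfl⟩ : ∃ j, i = j + 1 := ⟨i - 1, by omega⟩
    exact (hS.homology_exact₃ (j + 1) j rfl).isZero_of_both_zeros
      ((hs (j + 1) (by omega)).eq_of_src _ _) ((hs j (by omega)).eq_of_tgt _ _)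
  · have hmono : Mono (hS.δ (s + 1) s rfl) := hS.mono_δ _ _ _ (hs (s + 1) (by omega))
    let D : ((tensorComplex P).obj (ModuleCat.of A (QuotSMulTop x X))).homology (s + 1) →ₗ[A]
      ((tensorComplex P).obj X).homology s := (hS.δ (s + 1) s rfl).hom
    have hinj : Function.Injective D := (ModuleCat.mono_iff_injective _).1 hmono
    have hex := (ShortComplex.ShortExact.moduleCat_exact_iff_function_exact _).1
      (hS.homology_exact₁ (s + 1) s rfl)
    have hker : (HomologicalComplex.homologyMap ((tensorComplex P).map
        (ModuleCat.smulShortComplex X x).f) s).hom e = 0 := by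
      rw [ModuleCat.smulShortComplex_f_eq_smul_id]
      erw [tensorComplex_map_smul_id, homologyMap_smul_id]
      exact he
    obtain ⟨e', he'⟩ : ∃ e', D e' = e := (hex e).1 hker
    refine ⟨e', fun a ↦ ?_⟩
    rw [← map_eq_zero_iff D hinj, map_smul, he']

/-- If a weakly `X`-regular sequence annihilates an element of the top nonvanishing homology of
`X ⊗ P`, then, modulo the sequence, an element with the same annihilator appears in a degree
raised by the length of the sequence. -/
lemma exists_homology_of_isWeaklyRegular (P : ChainComplex (ModuleCat.{u} A) ℕ)
    [∀ n, Projective (P.X n)] (xs : List A) (X : ModuleCat.{u} A)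
    (hX : RingTheory.Sequence.IsWeaklyRegular X xs) (s : ℕ)
    (hs : ∀ i, s < i → Limits.IsZero (((tensorComplex P).obj X).homology i))
    (e : ((tensorComplex P).obj X).homology s) (he : ∀ x ∈ xs, x • e = 0) :
    ∃ (Y : ModuleCat.{u} A) (e' : ((tensorComplex P).obj Y).homology (s + xs.length)),
      ∀ a : A, a • e' = 0 ↔ a • e = 0 := by
  induction xs generalizing X s with
  | nil => exact ⟨X, e, fun _ ↦ Iff.rfl⟩
  | cons x xs ih =>
    rw [RingTheory.Sequence.isWeaklyRegular_cons_iff] at hX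
    obtain ⟨hs', e', he'⟩ := exists_homology_quotSMulTop P X hX.1 hs e (he x (by simp))
    obtain ⟨Y, e'', he''⟩ := ih (ModuleCat.of A (QuotSMulTop x X)) hX.2 (s + 1) hs' e'
      fun y hy ↦ (he' y).2 (he y (by simp [hy]))
    have hlen : s + 1 + xs.length = s + (x :: xs).length := by simp; omega
    rw [← hlen]
    exact ⟨Y, e'', fun a ↦ (he'' a).trans (he' a)⟩

end Tor

/-! ### Dimension shifting, and annihilation of Tor by elements outside a prime. -/

section DimensionShift

variable {A : Type u} [CommRing A]

/-- Splicing a complex augmented to the kernel of an epimorphism with that epimorphism. -/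
noncomputable abbrev spliceComplex (S : ShortComplex (ModuleCat.{u} A))
    (K : ChainComplex (ModuleCat.{u} A) ℕ) (ε : K.X 0 ⟶ S.X₁) (w : K.d 1 0 ≫ ε = 0) :
    ChainComplex (ModuleCat.{u} A) ℕ :=
  K.augment (ε ≫ S.f) (by rw [← Category.assoc, w, Limits.zero_comp])

section

variable (S : ShortComplex (ModuleCat.{u} A)) (K : ChainComplex (ModuleCat.{u} A) ℕ)
  (ε : K.X 0 ⟶ S.X₁) (w : K.d 1 0 ≫ ε = 0)

/-- The augmentation of a spliced complex. -/
noncomputable def spliceπ :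
    spliceComplex S K ε w ⟶ (ChainComplex.single₀ (ModuleCat.{u} A)).obj S.X₃ :=
  (ChainComplex.toSingle₀Equiv _ _).symm ⟨S.g, by
    have h : (ε ≫ S.f) ≫ S.g = 0 := by rw [Category.assoc, S.zero, Limits.comp_zero]
    exact h⟩

lemma spliceComplex_exact_zero (hS : S.ShortExact) [Epi ε] :
    (ShortComplex.mk (ε ≫ S.f) S.g (by rw [Category.assoc, S.zero, Limits.comp_zero])).Exact := by
  have hex := (ShortComplex.ShortExact.moduleCat_exact_iff_function_exact S).1 hS.exact
  have hε : Function.Surjective ε.hom := (ModuleCat.epi_iff_surjective _).1 inferInstance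
  rw [ShortComplex.ShortExact.moduleCat_exact_iff_function_exact]
  intro y
  refine (hex y).trans ⟨fun ⟨z, hz⟩ ↦ ?_, fun ⟨z, hz⟩ ↦ ⟨ε.hom z, hz⟩⟩
  obtain ⟨w, rfl⟩ := hε z
  exact ⟨w, hz⟩

lemma spliceComplex_exactAt_one (hS : S.ShortExact) (h : (ShortComplex.mk (K.d 1 0) ε w).Exact) :
    (spliceComplex S K ε w).ExactAt 1 := by
  have hf : Function.Injective S.f.hom := (ModuleCat.mono_iff_injective _).1 hS.mono_f
  rw [HomologicalComplex.exactAt_iff' _ 2 1 0 (by simp) (by simp),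
    ShortComplex.ShortExact.moduleCat_exact_iff_function_exact]
  rw [ShortComplex.ShortExact.moduleCat_exact_iff_function_exact] at h
  intro y
  exact Iff.trans (map_eq_zero_iff S.f.hom hf) (h y)

lemma spliceComplex_exactAt_succ_succ (n : ℕ) (h : K.ExactAt (n + 1)) :
    (spliceComplex S K ε w).ExactAt (n + 2) := by
  rw [HomologicalComplex.exactAt_iff' _ (n + 3) (n + 2) (n + 1) (by simp) (by simp)]
  rw [HomologicalComplex.exactAt_iff' _ (n + 2) (n + 1) n (by simp) (by simp)] at h
  exact h

lemma quasiIso_spliceπ (hS : S.ShortExact) [Epi ε] (h₀ : (ShortComplex.mk (K.d 1 0) ε w).Exact)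
    (h : ∀ n, K.ExactAt (n + 1)) : QuasiIso (spliceπ S K ε w) where
  quasiIsoAt n := by
    match n with
    | 0 =>
      rw [ChainComplex.quasiIsoAt₀_iff, ShortComplex.quasiIso_iff_of_zeros']
      · exact ⟨spliceComplex_exact_zero S K ε hS, hS.epi_g⟩
      all_goals rfl
    | 1 =>
      rw [quasiIsoAt_iff_exactAt']
      · exact spliceComplex_exactAt_one S K ε w hS h₀
      · apply ChainComplex.exactAt_succ_single_obj
    | n + 2 =>
      rw [quasiIsoAt_iff_exactAt']
      · exact spliceComplex_exactAt_succ_succ S K ε w n (h n)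
      · apply ChainComplex.exactAt_succ_single_obj

end

/-- Splicing a projective resolution of the kernel of an epimorphism from a projective object
gives a projective resolution of the target. -/
noncomputable def spliceResolution (S : ShortComplex (ModuleCat.{u} A))
    (hS : S.ShortExact) [hP : Projective S.X₂] (Q : ProjectiveResolution S.X₁) :
    ProjectiveResolution S.X₃ where
  complex := spliceComplex S Q.complex (Q.π.f 0) Q.complex_d_comp_π_f_zero
  projective n := match n with
    | 0 => hP
    | n + 1 => Q.projective n
  π := spliceπ S Q.complex (Q.π.f 0) Q.complex_d_comp_π_f_zero
  quasiIso :=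
    have : Epi (C := ModuleCat.{u} A) (Y := S.X₁) (Q.π.f 0) := inferInstanceAs (Epi (Q.π.f 0))
    quasiIso_spliceπ S Q.complex (Q.π.f 0) Q.complex_d_comp_π_f_zero hS Q.exact₀ fun n ↦ by
      rw [← quasiIsoAt_iff_exactAt' Q.π _ (by apply ChainComplex.exactAt_succ_single_obj)]
      infer_instance

/-- Dimension shifting for `Tor` in the resolved variable. -/
noncomputable def torSuccSuccIso (X : ModuleCat.{u} A) (S : ShortComplex (ModuleCat.{u} A))
    (hS : S.ShortExact) [Projective S.X₂] (n : ℕ) :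
    ((Tor (ModuleCat.{u} A) (n + 2)).obj X).obj S.X₃ ≅
      ((Tor (ModuleCat.{u} A) (n + 1)).obj X).obj S.X₁ :=
  let Q := projectiveResolution S.X₁
  let R := spliceResolution S hS Q
  let F := (MonoidalCategory.tensoringLeft (ModuleCat.{u} A)).obj X
  R.isoLeftDerivedObj F (n + 2) ≪≫
    -- Around degree `n + 2` the spliced complex is by definition `Q.complex` around degree `n + 1`,
    -- so the two short complexes agree.
    (((F.mapHomologicalComplex _).obj R.complex).homologyIsoSc' (n + 3) (n + 2) (n + 1)
      (by simp) (by simp)) ≪≫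
    (((F.mapHomologicalComplex _).obj Q.complex).homologyIsoSc' (n + 2) (n + 1) n
      (by simp) (by simp)).symm ≪≫
    (Q.isoLeftDerivedObj F (n + 1)).symm

/-- Multiplication by `a` on `M` lifts to multiplication by `a` on a resolution, which the additive
functor and homology preserve. -/
lemma leftDerived_tensoringLeft_map_smul_id (X M : ModuleCat.{u} A) (a : A) (n : ℕ) :
    (((MonoidalCategory.tensoringLeft (ModuleCat.{u} A)).obj X).leftDerived n).map (a • 𝟙 M) =
      a • 𝟙 _ := by
  let P := projectiveResolution M
  let F := (MonoidalCategory.tensoringLeft (ModuleCat.{u} A)).obj X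
  have h := P.isoLeftDerivedObj_hom_naturality (a • 𝟙 M) P (a • 𝟙 P.complex)
    (by
      rw [HomologicalComplex.smul_f_apply, HomologicalComplex.id_f, Linear.smul_comp,
        Category.id_comp]
      exact ((Linear.comp_smul _ _ _ (P.π.f 0) a (𝟙 M)).trans
        (congrArg (a • ·) (Category.comp_id (P.π.f 0)))).symm) F n
  have h1 : (F.mapHomologicalComplex _ ⋙ HomologicalComplex.homologyFunctor _ _ n).map
      (a • 𝟙 P.complex) = a • 𝟙 _ := by
    have : (F.mapHomologicalComplex (ComplexShape.down ℕ)).map (a • 𝟙 P.complex) = a • 𝟙 _ := by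
      ext i : 1
      simp [F]
    rw [Functor.comp_map, this]
    exact homologyMap_smul_id _ a n
  rw [h1, Linear.comp_smul] at h
  refine (cancel_mono (P.isoLeftDerivedObj F n).hom).1 (h.trans ?_)
  rw [Linear.smul_comp]
  exact congrArg (a • ·) ((Category.comp_id _).trans (Category.id_comp _).symm)

/-- An element annihilates the positive `Tor` modules of `M` once multiplication by it on `M`
factors through a projective module. -/
lemma smul_tor_eq_zero_of_factors {X M F : ModuleCat.{u} A} [Projective F] {a : A}
    (i : M ⟶ F) (π : F ⟶ M) (h : i ≫ π = a • 𝟙 M) (n : ℕ)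
    (e : ((Tor (ModuleCat.{u} A) (n + 1)).obj X).obj M) : a • e = 0 := by
  have h1 : ((Tor (ModuleCat.{u} A) (n + 1)).obj X).map (a • 𝟙 M) = a • 𝟙 _ :=
    leftDerived_tensoringLeft_map_smul_id X M a (n + 1)
  rw [← h, Functor.map_comp, (isZero_Tor_succ_of_projective _ X F n).eq_zero_of_tgt
    (((Tor (ModuleCat.{u} A) (n + 1)).obj X).map i), Limits.zero_comp] at h1
  exact congr($(h1).hom e).symm

/-- If `M` localizes to a module of projective dimension at most `d` at a prime `q`, then every
element of `Torₙ(X, M)` for `n > d` is annihilated by an element outside `q`. -/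
lemma exists_smul_tor_eq_zero [IsNoetherianRing A] (q : Ideal A) [q.IsPrime] (X : ModuleCat.{u} A)
    (d : ℕ) (M : ModuleCat.{u} A) [Module.Finite A M]
    (hM : HasProjectiveDimensionLE (M.localizedModule q.primeCompl) d) (n : ℕ) (hn : d < n)
    (e : ((Tor (ModuleCat.{u} A) n).obj X).obj M) : ∃ a ∉ q, a • e = 0 := by
  induction d generalizing M n with
  | zero =>
    obtain ⟨k, f, hf⟩ := Module.Finite.exists_fin' A M
    let S := q.primeCompl
    let F := ModuleCat.of A (Fin k → A)
    let lM := M.localizedModuleMkLinearMap S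
    let lF := F.localizedModuleMkLinearMap S
    have hlF : IsLocalizedModule S lF := ModuleCat.localizedModule_isLocalizedModule F S
    have hproj : Module.Projective (Localization S) (M.localizedModule S) :=
      (IsProjective.iff_projective _).2
        ((projective_iff_hasProjectiveDimensionLE_zero (M.localizedModule S)).2 hM)
    let fS := IsLocalizedModule.mapExtendScalars S lF lM (Localization S) f
    have hfS : Function.Surjective fS := IsLocalizedModule.map_surjective S lF lM f hf
    -- The localized surjection splits. Finite presentation of `M` descends the section to `h : M →
    -- F`, up to a denominator `s`.
    obtain ⟨σ, hσ⟩ := Module.projective_lifting_property fS LinearMap.id hfS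
    have : Module.FinitePresentation A M := Module.finitePresentation_of_finite A M
    obtain ⟨h, s, hs⟩ := Module.FinitePresentation.exists_lift_of_isLocalizedModule S lF
      ((σ.restrictScalars A).comp lM)
    have hcomp : lM ∘ₗ (f ∘ₗ h) = lM ∘ₗ ((s : A) • LinearMap.id) := by
      ext m
      have h1 : lF (h m) = s • σ (lM m) := congr($hs m)
      have h2 : fS (lF (h m)) = lM (f (h m)) := IsLocalizedModule.map_apply S lF lM f (h m)
      have h3 : fS (σ (lM m)) = lM m := congr($hσ (lM m))
      have h4 : fS ((s : A) • σ (lM m)) = (s : A) • fS (σ (lM m)) :=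
        (fS.restrictScalars A).map_smul _ _
      simp only [LinearMap.comp_apply, LinearMap.smul_apply, LinearMap.id_apply, map_smul]
      rw [← h2, h1]
      exact h4.trans (by rw [h3])
    -- `f ∘ h` equals `s` only after localization; `t` clears the discrepancy, so multiplication by
    -- `t * s` factors through the free module `F`.
    obtain ⟨t, ht⟩ := Module.Finite.exists_smul_of_comp_eq_of_isLocalizedModule S lM _ _ hcomp
    obtain ⟨n, rfl⟩ : ∃ j, n = j + 1 := ⟨n - 1, by omega⟩
    refine ⟨t * s, (t * s).2, ?_⟩
    have : Projective F := (IsProjective.iff_projective (Fin k → A)).1 inferInstance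
    refine smul_tor_eq_zero_of_factors (ModuleCat.ofHom ((t : A) • h)) (ModuleCat.ofHom f) ?_ n e
    ext m
    have h5 : (t : A) • f (h m) = (t : A) • ((s : A) • m) := congr($ht m)
    change f ((t : A) • h m) = ((t : A) * (s : A)) • m
    rw [map_smul, h5, mul_smul]
  | succ d ih =>
    obtain ⟨k, f, hf⟩ := Module.Finite.exists_fin' A M
    let S : ShortComplex (ModuleCat.{u} A) := ModuleCat.shortComplexOfCompEqZero
      (LinearMap.ker f).subtype f (by ext x; exact x.2)
    have hS : S.ShortExact :=
      { exact := ModuleCat.shortComplex_exact _ (LinearMap.exact_subtype_ker_map f)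
        mono_f := (ModuleCat.mono_iff_injective _).2 Subtype.val_injective
        epi_g := (ModuleCat.epi_iff_surjective _).2 hf }
    have hX₂ : Projective S.X₂ := (IsProjective.iff_projective (Fin k → A)).1 inferInstance
    let T := S.map (ModuleCat.localizedModuleFunctor q.primeCompl)
    have hT : T.ShortExact := hS.map_of_exact (ModuleCat.localizedModuleFunctor q.primeCompl)
    have hTX₂ : Projective T.X₂ :=
      (ModuleCat.localizedModuleFunctor q.primeCompl).projective_obj S.X₂
    have hT₁ := (hT.hasProjectiveDimensionLT_X₃_iff d hTX₂).1 hM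
    obtain ⟨n, rfl⟩ : ∃ j, n = j + 2 := ⟨n - 2, by omega⟩
    have : Module.Finite A S.X₁ := inferInstanceAs (Module.Finite A (LinearMap.ker f))
    let φ := torSuccSuccIso X S hS n
    obtain ⟨a, haq, ha⟩ := ih S.X₁ hT₁ (n + 1) (by omega) (φ.hom.hom e)
    refine ⟨a, haq, ?_⟩
    have h : φ.inv.hom (φ.hom.hom (a • e)) = a • e := congr($(φ.hom_inv_id).hom (a • e))
    rw [← h, map_smul, ha, map_zero]

end DimensionShift

/-! ### The Auslander-Buchsbaum inequality. -/

section AuslanderBuchsbaum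

open RingTheory.Sequence IsLocalRing

/-- Reducing a short exact sequence modulo a sequence regular on its last term keeps it exact on the
left. -/
lemma mem_smul_top_of_isWeaklyRegular_of_exact {R : Type*} [CommRing R] {F N : Type*}
    [AddCommGroup F] [Module R F] [AddCommGroup N] [Module R N] {f : F →ₗ[R] N}
    (hf : Function.Surjective f) {rs : List R} (h : IsWeaklyRegular N rs) {v : LinearMap.ker f}
    (hv : (v : F) ∈ Ideal.ofList rs • (⊤ : Submodule R F)) :
    v ∈ Ideal.ofList rs • (⊤ : Submodule R (LinearMap.ker f)) := by
  have h0 : Function.Exact (0 : PUnit.{1} →ₗ[R] LinearMap.ker f) (LinearMap.ker f).subtype := by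
    rw [LinearMap.exact_zero_iff_injective]
    exact Subtype.val_injective
  have hex := map_first_exact_on_four_term_right_exact_of_isSMulRegular_last h0
    (LinearMap.exact_subtype_ker_map f) hf h
  rw [← Submodule.Quotient.mk_eq_zero]
  obtain ⟨y, hy⟩ := (hex (Submodule.Quotient.mk v)).1
    (by simpa using (Submodule.Quotient.mk_eq_zero _).2 hv)
  obtain ⟨y, rfl⟩ := Submodule.Quotient.mk_surjective _ y
  rw [← hy]
  simp

/-- If the first `j` terms of a sequence are weakly regular on a quotient of a module on which the
sequence is weakly regular, then the first `j + 1` terms are weakly regular on the kernel. -/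
lemma isWeaklyRegular_take_succ_ker {R : Type*} [CommRing R] {F N : Type*}
    [AddCommGroup F] [Module R F] [AddCommGroup N] [Module R N] {f : F →ₗ[R] N}
    (hf : Function.Surjective f) {rs : List R} (hF : IsWeaklyRegular F rs) {j : ℕ}
    (h : IsWeaklyRegular N (rs.take j)) :
    IsWeaklyRegular (LinearMap.ker f) (rs.take (j + 1)) := by
  refine ⟨fun i hi ↦ ?_⟩
  rw [List.length_take, lt_min_iff] at hi
  -- Testing the term of index `i` on the kernel needs regularity on `N` of the preceding `i` terms
  -- only; this is the gain of one.
  have hij : i ≤ j := by omega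
  have hN : IsWeaklyRegular N (rs.take i) := by
    have h1 : rs.take j = rs.take i ++ (rs.take j).drop i := by
      conv_lhs => rw [← List.take_append_drop i (rs.take j)]
      rw [List.take_take, min_eq_left hij]
    rw [h1] at h
    exact ((isWeaklyRegular_append_iff N _ _).1 h).1
  rw [List.take_take, min_eq_left (by omega), List.getElem_take,
    isSMulRegular_quotient_iff_mem_of_smul_mem]
  intro v hv
  refine mem_smul_top_of_isWeaklyRegular_of_exact hf hN ?_
  refine (isSMulRegular_quotient_iff_mem_of_smul_mem _ _).1 (hF.regular_mod_prev i hi.2) _ ?_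
  have := Submodule.mem_map_of_mem (f := (LinearMap.ker f).subtype) hv
  rw [Submodule.map_smul''] at this
  exact Submodule.smul_mono le_rfl le_top this

/-- Over a local ring, a module with a two-term free resolution is free if it has a weakly regular
sequence modulo which the ring has depth zero. -/
lemma free_of_isWeaklyRegular_of_free_ker {R : Type u} [CommRing R] [IsLocalRing R]
    [IsNoetherianRing R] {N : Type u} [AddCommGroup N] [Module R N] {k : ℕ}
    {f : (Fin k → R) →ₗ[R] N} (hf : Function.Surjective f) {rs : List R}
    (h : IsWeaklyRegular N rs) {z : R} (hz : z ∉ Ideal.ofList rs)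
    (hmz : ∀ a ∈ maximalIdeal R, a * z ∈ Ideal.ofList rs) [Module.Free R (LinearMap.ker f)] :
    Module.Free R N := by
  refine Module.free_of_lTensor_residueField_injective (LinearMap.ker f).subtype f hf
    (LinearMap.exact_subtype_ker_map f) ?_
  rw [← LinearMap.ker_eq_bot, eq_bot_iff]
  intro t ht
  obtain ⟨v, rfl⟩ := TensorProduct.mk_surjective R (LinearMap.ker f) (ResidueField R)
    Ideal.Quotient.mk_surjective t
  have hv : (v : Fin k → R) ∈ maximalIdeal R • (⊤ : Submodule R (Fin k → R)) := by
    rw [← Submodule.Quotient.mk_eq_zero, ← TensorProduct.quotTensorEquivQuotSMul_mk_one_tmul]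
    exact (LinearEquiv.map_eq_zero_iff _).2 ht
  -- Multiplication by the socle representative `z` carries `v` into `(rs)F`, hence into `(rs)`
  -- times the free kernel. A unit coordinate of `v` would then put `z` in `(rs)`.
  have hzv : ((z • v : LinearMap.ker f) : Fin k → R) ∈
      Ideal.ofList rs • (⊤ : Submodule R (Fin k → R)) := by
    refine Submodule.smul_induction_on (p := fun w ↦ z • w ∈
      Ideal.ofList rs • (⊤ : Submodule R (Fin k → R))) hv (fun a ha w _ ↦ ?_) fun x y hx hy ↦ ?_
    · rw [smul_smul, mul_comm]
      exact Submodule.smul_mem_smul (hmz a ha) trivial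
    · rw [smul_add]
      exact add_mem hx hy
  have hzv' := mem_smul_top_of_isWeaklyRegular_of_exact hf h hzv
  let b := Module.Free.chooseBasis R (LinearMap.ker f)
  have hcoord : ∀ i, b.repr v i ∈ maximalIdeal R := by
    intro i
    by_contra hi
    have hu : IsUnit (b.repr v i) := by simpa using hi
    have h1 : b.coord i (z • v) ∈ Ideal.ofList rs := by
      have := Submodule.mem_map_of_mem (f := b.coord i) hzv'
      rw [Submodule.map_smul''] at this
      simpa using Submodule.smul_mono (le_refl (Ideal.ofList rs)) le_top this
    rw [map_smul, Module.Basis.coord_apply, smul_eq_mul] at h1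
    exact hz ((Ideal.mul_unit_mem_iff_mem _ hu).1 h1)
  have hmem : v ∈ maximalIdeal R • (⊤ : Submodule R (LinearMap.ker f)) := by
    rw [← b.sum_repr v]
    exact Submodule.sum_mem _ fun i _ ↦ Submodule.smul_mem_smul (hcoord i) trivial
  rw [← Submodule.Quotient.mk_eq_zero, ← TensorProduct.quotTensorEquivQuotSMul_mk_one_tmul] at hmem
  exact (LinearEquiv.map_eq_zero_iff _).1 hmem

/-- Passing to a syzygy lowers the projective dimension and lengthens the regular prefix by one. The
bound `n` serves only to make the induction end; letting `j` vary makes it close. -/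
lemma hasProjectiveDimensionLE_sub_of_isWeaklyRegular_take {R : Type u} [CommRing R]
    [IsLocalRing R] [IsNoetherianRing R] {rs : List R} (hrs : IsWeaklyRegular R rs) {z : R}
    (hz : z ∉ Ideal.ofList rs) (hmz : ∀ a ∈ maximalIdeal R, a * z ∈ Ideal.ofList rs)
    (n : ℕ) (N : ModuleCat.{u} R) [Module.Finite R N] [HasProjectiveDimensionLE N n] (j : ℕ)
    (hj : IsWeaklyRegular N (rs.take j)) :
    HasProjectiveDimensionLE N (rs.length - j) := by
  induction n generalizing N j with
  | zero => exact hasProjectiveDimensionLT_of_ge N 1 _ (by omega)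
  | succ n ih =>
    obtain ⟨k, f, hf⟩ := Module.Finite.exists_fin' R N
    let S : ShortComplex (ModuleCat.{u} R) := ModuleCat.shortComplexOfCompEqZero
      (LinearMap.ker f).subtype f (by ext x; exact x.2)
    have hS : S.ShortExact :=
      { exact := ModuleCat.shortComplex_exact _ (LinearMap.exact_subtype_ker_map f)
        mono_f := (ModuleCat.mono_iff_injective _).2 Subtype.val_injective
        epi_g := (ModuleCat.epi_iff_surjective _).2 hf }
    have hX₂ : Projective S.X₂ := (IsProjective.iff_projective (Fin k → R)).1 inferInstance
    have h₁ : HasProjectiveDimensionLE S.X₁ n := (hS.hasProjectiveDimensionLT_X₃_iff n hX₂).1 ‹_›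
    have : Module.Finite R S.X₁ := inferInstanceAs (Module.Finite R (LinearMap.ker f))
    have hF : IsWeaklyRegular (Fin k → R) rs :=
      ((TensorProduct.rid R (Fin k → R)).isWeaklyRegular_congr rs).1
        (hrs.isWeaklyRegular_lTensor (M₂ := Fin k → R))
    have hK := ih S.X₁ (j + 1) (isWeaklyRegular_take_succ_ker hf hF hj)
    rcases lt_or_ge j rs.length with hlt | hge
    · obtain ⟨c, hc⟩ : ∃ c, rs.length - j = c + 1 := ⟨rs.length - j - 1, by omega⟩
      rw [show rs.length - (j + 1) = c by omega] at hK
      rw [hc]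
      exact (hS.hasProjectiveDimensionLT_X₃_iff c hX₂).2 hK
    -- Here both truncated differences are `0`: the syzygy is free and all of `rs` is regular on
    -- `N`, so the socle argument applies.
    · rw [Nat.sub_eq_zero_of_le (by omega)] at hK ⊢
      rw [List.take_of_length_le hge] at hj
      have hproj : Module.Projective R (LinearMap.ker f) :=
        (IsProjective.iff_projective _).2
          ((projective_iff_hasProjectiveDimensionLE_zero S.X₁).2 hK)
      have : Module.Free R (LinearMap.ker f) := Module.free_of_flat_of_isLocalRing
      have : Module.Free R N := free_of_isWeaklyRegular_of_free_ker hf hj hz hmz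
      exact (projective_iff_hasProjectiveDimensionLE_zero N).1
        ((IsProjective.iff_projective N).1 (Module.Projective.of_free (R := R) (P := N)))

/-- The Auslander-Buchsbaum inequality. -/
lemma hasProjectiveDimensionLE_length_of_maximal {R : Type u} [CommRing R]
    [IsLocalRing R] [IsNoetherianRing R] {rs : List R} (hrs : IsWeaklyRegular R rs) {z : R}
    (hz : z ∉ Ideal.ofList rs) (hmz : ∀ a ∈ maximalIdeal R, a * z ∈ Ideal.ofList rs)
    (n : ℕ) (N : ModuleCat.{u} R) [Module.Finite R N] [HasProjectiveDimensionLE N n] :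
    HasProjectiveDimensionLE N rs.length :=
  hasProjectiveDimensionLE_sub_of_isWeaklyRegular_take hrs hz hmz n N 0
    (by rw [List.take_zero]; exact IsWeaklyRegular.nil R N)

end AuslanderBuchsbaum

/-! ### Associated primes and the length of regular sequences. -/

section RegularSequences

open RingTheory.Sequence IsLocalRing Pointwise

lemma IsAssociatedPrime.exists_mem_iff {R M : Type*} [CommRing R] [IsNoetherianRing R]
    [AddCommGroup M] [Module R M] {Q : Ideal R} (h : IsAssociatedPrime Q M) :
    ∃ x : M, ∀ a : R, a ∈ Q ↔ a • x = 0 := by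
  obtain ⟨-, x, rfl⟩ := isAssociatedPrime_iff.1 h
  exact ⟨x, fun a ↦ by simp [Submodule.mem_colon_singleton]⟩

variable {R : Type*} [CommRing R] [IsLocalRing R] [IsNoetherianRing R]

/-- Passing to the quotient by a regular element strictly enlarges a given associated prime. -/
lemma exists_lt_isAssociatedPrime_quotSMulTop {N : Type*} [AddCommGroup N] [Module R N]
    [Module.Finite R N] {x : R} (hxm : x ∈ maximalIdeal R) (hx : IsSMulRegular N x)
    {Q : Ideal R} (hQ : IsAssociatedPrime Q N) :
    ∃ Q', IsAssociatedPrime Q' (QuotSMulTop x N) ∧ Q < Q' := by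
  obtain ⟨y, hy⟩ := hQ.exists_mem_iff
  have hy0 : y ≠ 0 := fun h ↦ hQ.isPrime.ne_top ((Ideal.eq_top_iff_one _).2 ((hy 1).2 (by simp [h])))
  let T : Submodule R N :=
    { carrier := {z | ∀ a ∈ Q, a • z = 0}
      add_mem' := fun h h' a ha ↦ by rw [smul_add, h a ha, h' a ha, add_zero]
      zero_mem' := fun a _ ↦ smul_zero a
      smul_mem' := fun c z h a ha ↦ by rw [smul_comm, h a ha, smul_zero] }
  have hT : T ≠ ⊥ := fun h ↦ hy0 ((Submodule.eq_bot_iff _).1 h y fun a ha ↦ (hy a).1 ha)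
  -- Otherwise every element of `T` is `x • w`, and regularity of `x` puts `w` in `T`; so `T = xT`,
  -- and Nakayama gives `T = 0`.
  obtain ⟨z, hzT, hz⟩ : ∃ z ∈ T, z ∉ x • (⊤ : Submodule R N) := by
    by_contra! hcon
    refine hT (Submodule.eq_bot_of_le_smul_of_le_jacobson_bot (maximalIdeal R) T
      (IsNoetherian.noetherian T) (fun z hz ↦ ?_) (maximalIdeal_le_jacobson ⊥))
    obtain ⟨w, -, rfl⟩ := (Submodule.mem_smul_pointwise_iff_exists _ _ _).1 (hcon z hz)
    refine Submodule.smul_mem_smul hxm fun a ha ↦ hx.right_eq_zero_of_smul ?_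
    rw [smul_comm]
    exact hz a ha
  obtain ⟨Q', hQ', hle⟩ := exists_le_isAssociatedPrime_of_isNoetherianRing R
    (Submodule.Quotient.mk z : QuotSMulTop x N) (fun h ↦ hz ((Submodule.Quotient.mk_eq_zero _).1 h))
  have hmem : ∀ a : R, a • z ∈ x • (⊤ : Submodule R N) → a ∈ Q' := fun a ha ↦ hle <| by
    rw [Submodule.mem_colon_singleton, Submodule.mem_bot]
    exact (Submodule.Quotient.mk_eq_zero _).2 ha
  refine ⟨Q', hQ', lt_of_le_of_ne (fun a ha ↦ hmem a ?_) ?_⟩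
  · rw [hzT a ha]
    exact zero_mem _
  · rintro rfl
    have : x ∈ Q := hmem x (Submodule.smul_mem_pointwise_smul _ _ _ trivial)
    exact hy0 (hx.right_eq_zero_of_smul ((hy x).1 this))

/-- The length of a regular sequence is bounded by the growth, from an associated prime to the
maximal ideal, of any strictly monotone function on primes. -/
lemma add_length_le_of_isWeaklyRegular (φ : Ideal R → ℕ∞) (Q₀ : Ideal R)
    (hφ : ∀ Q Q' : Ideal R, Q.IsPrime → Q'.IsPrime → Q₀ ≤ Q → Q < Q' → φ Q + 1 ≤ φ Q')
    (ys : List R) (hys : ∀ y ∈ ys, y ∈ maximalIdeal R) {N : Type*} [AddCommGroup N] [Module R N]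
    [Module.Finite R N] (hN : IsWeaklyRegular N ys) {Q : Ideal R} (hQ : IsAssociatedPrime Q N)
    (hQ₀ : Q₀ ≤ Q) : φ Q + ys.length ≤ φ (maximalIdeal R) := by
  induction ys generalizing N Q with
  | nil =>
    rw [List.length_nil, Nat.cast_zero, add_zero]
    rcases (le_maximalIdeal hQ.isPrime.ne_top).eq_or_lt with h | h
    · rw [h]
    · exact le_self_add.trans (hφ Q _ hQ.isPrime inferInstance hQ₀ h)
  | cons y ys ih =>
    rw [isWeaklyRegular_cons_iff] at hN
    obtain ⟨Q', hQ', hlt⟩ := exists_lt_isAssociatedPrime_quotSMulTop (hys y (by simp)) hN.1 hQ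
    have h1 := ih (fun z hz ↦ hys z (by simp [hz])) hN.2 hQ' (hQ₀.trans hlt.le)
    have h2 := hφ Q Q' hQ.isPrime hQ'.isPrime hQ₀ hlt
    calc φ Q + ((y :: ys).length : ℕ) = (φ Q + 1) + (ys.length : ℕ) := by
          rw [List.length_cons, Nat.cast_succ, add_assoc, add_comm (1 : ℕ∞)]
      _ ≤ φ Q' + (ys.length : ℕ) := by gcongr
      _ ≤ _ := h1

/-- A weakly regular sequence extends within an ideal to one that is maximal in the ideal, so that
the ideal is contained in an associated prime of the resulting quotient. -/
lemma exists_isWeaklyRegular_append_maximal {N : Type*} [AddCommGroup N] [Module R N]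
    [Module.Finite R N] [Nontrivial N] {I : Ideal R} (hI : I ≤ maximalIdeal R) (rs : List R)
    (hrs : ∀ r ∈ rs, r ∈ maximalIdeal R) (hreg : IsWeaklyRegular N rs) :
    ∃ ys : List R, (∀ y ∈ ys, y ∈ I) ∧ IsWeaklyRegular N (rs ++ ys) ∧
      ∃ Q, IsAssociatedPrime Q (N ⧸ (Ideal.ofList (rs ++ ys) • ⊤ : Submodule R N)) ∧ I ≤ Q := by
  by_contra! hcon
  have hext : ∀ n : ℕ, ∃ ys : List R, (∀ y ∈ ys, y ∈ I) ∧ IsWeaklyRegular N (rs ++ ys) ∧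
      ys.length = n := by
    intro n
    induction n with
    | zero => exact ⟨[], by simp, by simpa using hreg, rfl⟩
    | succ n ih =>
      obtain ⟨ys, hys, hreg', hlen⟩ := ih
      let L := N ⧸ (Ideal.ofList (rs ++ ys) • ⊤ : Submodule R N)
      -- Prime avoidance over the finitely many associated primes of `L` yields an element of `I`
      -- regular on `L`.
      have hnot : ¬ (I : Set R) ⊆ ⋃ Q ∈ associatedPrimes R L, Q := by
        intro h
        obtain ⟨Q, hQ, hIQ⟩ := (I.subset_union_prime_finite (associatedPrimes.finite R L)
          (f := id) 0 0 fun _ h _ _ ↦ h.isPrime).1 h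
        exact hcon ys hys hreg' Q hQ hIQ
      obtain ⟨x, hxI, hx⟩ := Set.not_subset.1 hnot
      rw [biUnion_associatedPrimes_eq_compl_regular, Set.mem_compl_iff, not_not] at hx
      refine ⟨ys ++ [x], ?_, ?_, by simp [hlen]⟩
      · intro y hy
        rcases List.mem_append.1 hy with hy | hy
        · exact hys y hy
        · rwa [List.mem_singleton.1 hy]
      · rw [← List.append_assoc, isWeaklyRegular_append_iff]
        exact ⟨hreg', (isWeaklyRegular_singleton_iff _ _).2 hx⟩
  obtain ⟨Q, hQ⟩ := associatedPrimes.nonempty R N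
  have hfin : (maximalIdeal R).height ≠ ⊤ := Ideal.height_ne_top_of_isPrime
  obtain ⟨h, hh⟩ := ENat.ne_top_iff_exists.1 hfin
  obtain ⟨ys, hys, hreg', hlen⟩ := hext (h + 1)
  -- With height as the monotone function, lengths are bounded by the finite height of the maximal
  -- ideal, so extension cannot go on forever.
  have hle := add_length_le_of_isWeaklyRegular (R := R) Ideal.height ⊥
    (fun Q Q' hQ hQ' _ hlt ↦ Ideal.height_add_one_le_of_lt_of_isPrime hlt) (rs ++ ys)
    (fun y hy ↦ (List.mem_append.1 hy).elim (hrs y) fun h ↦ hI (hys y h)) hreg' hQ bot_le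
  rw [← hh] at hle
  have h3 : ((h + 1 : ℕ) : ℕ∞) ≤ (h : ℕ) := by
    refine le_trans ?_ (le_add_self.trans hle)
    rw [List.length_append, hlen]
    exact_mod_cast Nat.le_add_left _ _
  have : h + 1 ≤ h := by exact_mod_cast h3
  omega

end RegularSequences

/-! ### Systems of parameters adapted to a prime. -/

section SystemsOfParameters

open IsLocalRing

variable {R : Type u} [CommRing R]

/-- An ideal of height `h` contains `h` elements generating an ideal of height `h`. -/
lemma exists_list_height_ofList_eq [IsNoetherianRing R] (I : Ideal R) (hI : I ≠ ⊤) :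
    ∃ xs : List R, (∀ x ∈ xs, x ∈ I) ∧ (xs.length : ℕ∞) = I.height ∧
      (Ideal.ofList xs).height = I.height := by
  obtain ⟨J, hJI, hrank, hheight⟩ := I.exists_spanRank_eq_and_height_eq hI
  have hfg : J.FG := IsNoetherian.noetherian J
  obtain ⟨s, hcard, hspan⟩ := Submodule.FG.exists_span_finset_card_eq_spanFinrank hfg
  have hJ : Ideal.ofList s.toList = J := by
    rw [← hspan]
    simp [Ideal.ofList]
  refine ⟨s.toList, fun x hx ↦ hJI ?_, ?_, by rw [hJ, hheight]⟩
  · rw [← hJ]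
    exact Ideal.subset_span hx
  · rw [Finset.length_toList, hcard]
    rw [Submodule.FG.spanRank_eq_spanFinrank hfg] at hrank
    exact_mod_cast hrank

/-- A chain of `n` steps below `Q` lifts to a chain whose bottom prime contains `J`, hence has
height at least that of `J`. -/
lemma height_add_le_height_comap (J : Ideal R) (n : ℕ) (Q : Ideal (R ⧸ J)) [Q.IsPrime]
    (hn : (n : ℕ∞) ≤ Q.height) : J.height + n ≤ (Q.comap (Ideal.Quotient.mk J)).height := by
  induction n generalizing Q with
  | zero =>
    rw [Nat.cast_zero, add_zero]
    exact Ideal.height_mono (by simpa using Ideal.ker_le_comap (K := Q) (Ideal.Quotient.mk J))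
  | succ n ih =>
    have h1 : ¬ Order.height (⟨Q, inferInstance⟩ : PrimeSpectrum (R ⧸ J)) ≤ n := by
      rw [← PrimeSpectrum.height_eq_orderHeight, not_le]
      exact lt_of_lt_of_le (by exact_mod_cast n.lt_succ_self) hn
    rw [Order.height_le_coe_iff] at h1
    push Not at h1
    obtain ⟨P, hPQ, hP⟩ := h1
    rw [← PrimeSpectrum.height_eq_orderHeight] at hP
    have hlt : P.asIdeal.comap (Ideal.Quotient.mk J) < Q.comap (Ideal.Quotient.mk J) :=
      lt_of_le_of_ne (Ideal.comap_mono hPQ.le) fun h ↦ hPQ.ne <| PrimeSpectrum.ext <|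
        Ideal.comap_injective_of_surjective _ Ideal.Quotient.mk_surjective h
    calc J.height + (n + 1 : ℕ) = J.height + n + 1 := by rw [Nat.cast_succ, add_assoc]
      _ ≤ (P.asIdeal.comap (Ideal.Quotient.mk J)).height + 1 := by gcongr; exact ih _ hP
      _ ≤ _ := Ideal.height_add_one_le_of_lt_of_isPrime hlt

/-- A prime `q` of a noetherian local ring contains an initial segment of length `height q` of a
system of parameters. -/
lemma exists_isSystemOfParameters_append [IsNoetherianRing R] [IsLocalRing R] (q : Ideal R)
    [q.IsPrime] :
    ∃ xs ys : List R, (∀ x ∈ xs, x ∈ q) ∧ (xs.length : ℕ∞) = q.height ∧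
      IsSystemOfParameters R (xs ++ ys) := by
  obtain ⟨xs, hxq, hxlen, hxheight⟩ := exists_list_height_ofList_eq q (Ideal.IsPrime.ne_top ‹_›)
  set J := Ideal.ofList xs with hJ
  have hJq : J ≤ q := Ideal.span_le.2 hxq
  have hJtop : J ≠ ⊤ := ne_top_of_le_ne_top (Ideal.IsPrime.ne_top ‹_›) hJq
  have : Nontrivial (R ⧸ J) := Ideal.Quotient.nontrivial_iff.2 hJtop
  have : IsLocalRing (R ⧸ J) :=
    .of_surjective' (Ideal.Quotient.mk J) Ideal.Quotient.mk_surjective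
  obtain ⟨ys', hym, hylen, hyheight⟩ := exists_list_height_ofList_eq (maximalIdeal (R ⧸ J))
    (Ideal.IsPrime.ne_top inferInstance)
  obtain ⟨ys, rfl⟩ : ∃ ys : List R, ys.map (Ideal.Quotient.mk J) = ys' :=
    List.map_surjective_iff.2 Ideal.Quotient.mk_surjective ys'
  have hle : Ideal.ofList (xs ++ ys) ≤ maximalIdeal R := by
    rw [Ideal.ofList_append]
    refine sup_le (hJq.trans (le_maximalIdeal (Ideal.IsPrime.ne_top ‹_›)))
      (Ideal.span_le.2 fun y hy ↦ ?_)
    have h1 := hym _ (List.mem_map_of_mem (f := Ideal.Quotient.mk J) hy)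
    rw [mem_maximalIdeal, mem_nonunits_iff] at h1
    exact fun hu ↦ h1 (hu.map (Ideal.Quotient.mk J))
  have hprime : ∀ P : Ideal R, P.IsPrime → Ideal.ofList (xs ++ ys) ≤ P → P = maximalIdeal R := by
    intro P hP hIP
    rw [Ideal.ofList_append] at hIP
    have hker : RingHom.ker (Ideal.Quotient.mk J) ≤ P := by
      rw [Ideal.mk_ker]
      exact le_sup_left.trans hIP
    have hP' : (P.map (Ideal.Quotient.mk J)).IsPrime :=
      Ideal.map_isPrime_of_surjective Ideal.Quotient.mk_surjective hker
    have hPm : P.map (Ideal.Quotient.mk J) = maximalIdeal (R ⧸ J) := by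
      refine Ideal.eq_of_le_of_height_le _ (le_maximalIdeal hP'.ne_top) ?_
      rw [← hyheight, ← Ideal.map_ofList]
      exact Ideal.height_mono (Ideal.map_mono (le_sup_right.trans hIP))
    have hcomap := congrArg (Ideal.comap (Ideal.Quotient.mk J)) hPm
    rw [Ideal.comap_map_of_surjective' _ Ideal.Quotient.mk_surjective, sup_eq_left.2 hker] at hcomap
    rw [hcomap]
    have : (Ideal.comap (Ideal.Quotient.mk J) (maximalIdeal (R ⧸ J))).IsMaximal :=
      Ideal.comap_isMaximal_of_surjective _ Ideal.Quotient.mk_surjective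
    exact eq_maximalIdeal this
  have hrad : (Ideal.ofList (xs ++ ys)).radical = maximalIdeal R := by
    refine le_antisymm ?_ ?_
    · exact (Ideal.IsPrime.radical_le_iff inferInstance).2 hle
    · rw [Ideal.radical_eq_sInf]
      exact le_sInf fun P hP ↦ (hprime P hP.2 hP.1).ge
  refine ⟨xs, ys, hxq, hxlen, ?_, hrad⟩
  rw [← maximalIdeal_height_eq_ringKrullDim]
  congr 1
  rw [List.length_append, Nat.cast_add]
  -- One bound is `ht J + dim R/J ≤ dim R`; the other is Krull's height theorem, the maximal ideal
  -- being minimal over the generated ideal.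
  refine le_antisymm ?_ ?_
  · rw [hxlen, ← hxheight]
    rw [List.length_map] at hylen
    refine (height_add_le_height_comap J ys.length (maximalIdeal (R ⧸ J)) hylen.le).trans
      (Ideal.height_mono (le_maximalIdeal ?_))
    exact Ideal.IsPrime.ne_top inferInstance
  · classical
    have hmin : maximalIdeal R ∈ (Ideal.span ((xs ++ ys).toFinset : Set R)).minimalPrimes := by
      have hspan : Ideal.span ((xs ++ ys).toFinset : Set R) = Ideal.ofList (xs ++ ys) := by
        rw [List.coe_toFinset, Ideal.ofList]
      rw [hspan]
      exact ⟨⟨inferInstance, hle⟩, fun P hP _ ↦ (hprime P hP.1 hP.2).ge⟩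
    refine (Ideal.height_le_card_of_mem_minimalPrimes_span_finset hmin).trans ?_
    rw [← Nat.cast_add, ← List.length_append]
    exact_mod_cast List.toFinset_card_le _

end SystemsOfParameters

/-! ### Projective dimension over `A_q` and regular sequences on `C`. -/

section DepthAndTor

open RingTheory.Sequence IsLocalRing

/-- `A_p` is a localization of `A_q`, hence flat, so weak regularity survives; the image lies in the
maximal ideal, which makes it regular. -/
lemma length_le_localRingDepth_of_le {A : Type u} [CommRing A] [IsNoetherianRing A]
    {p q : Ideal A} [p.IsPrime] [q.IsPrime] (hpq : p ≤ q)
    {rs : List (Localization.AtPrime q)} (hrs : IsWeaklyRegular (Localization.AtPrime q) rs)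
    (hmem : ∀ r ∈ rs, r ∈ p.map (algebraMap A (Localization.AtPrime q))) :
    (rs.length : ℕ∞) ≤ localRingDepth (Localization.AtPrime p) := by
  have hle : q.primeCompl ≤ p.primeCompl := fun x hx hxp ↦ hx (hpq hxp)
  let := IsLocalization.localizationAlgebraOfSubmonoidLe (Localization.AtPrime q)
    (Localization.AtPrime p) q.primeCompl p.primeCompl hle
  have := IsLocalization.localization_isScalarTower_of_submonoid_le (Localization.AtPrime q)
    (Localization.AtPrime p) q.primeCompl p.primeCompl hle
  have := IsLocalization.isLocalization_of_submonoid_le (Localization.AtPrime q)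
    (Localization.AtPrime p) q.primeCompl p.primeCompl hle
  have hreg := hrs.of_isLocalization (Localization.AtPrime p)
    (p.primeCompl.map (algebraMap A (Localization.AtPrime q)))
  have hmem' : ∀ r ∈ rs.map (algebraMap (Localization.AtPrime q) (Localization.AtPrime p)),
      r ∈ maximalIdeal (Localization.AtPrime p) := by
    intro r hr
    obtain ⟨r, hr', rfl⟩ := List.mem_map.1 hr
    have h1 := Ideal.mem_map_of_mem (algebraMap (Localization.AtPrime q) (Localization.AtPrime p))
      (hmem r hr')
    rw [Ideal.map_map, ← IsScalarTower.algebraMap_eq] at h1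
    rwa [← Localization.AtPrime.map_eq_maximalIdeal]
  rw [localRingDepth]
  refine le_iSup₂_of_le _ ⟨hmem',
    (IsLocalRing.isRegular_iff_isWeaklyRegular_of_subset_maximalIdeal hmem').2 hreg⟩ ?_
  rw [List.length_map]

/-- Finite projective dimensions over `A_q` are bounded by `depth A_p + height (q / p)`. -/
lemma exists_hasProjectiveDimensionLE_add {A : Type u} [CommRing A] [IsNoetherianRing A]
    {p q : Ideal A} [p.IsPrime] [q.IsPrime] (hpq : p ≤ q) :
    ∃ t l : ℕ, (t : ℕ∞) ≤ localRingDepth (Localization.AtPrime p) ∧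
      (l : ℕ∞) ≤ (q.map (Ideal.Quotient.mk p)).height ∧
      ∀ (n : ℕ) (N : ModuleCat.{u} (Localization.AtPrime q))
        [Module.Finite (Localization.AtPrime q) N] [HasProjectiveDimensionLE N n],
        HasProjectiveDimensionLE N (t + l) := by
  let R := Localization.AtPrime q
  let P : Ideal R := p.map (algebraMap A R)
  have hm : (maximalIdeal R).comap (algebraMap A R) = q := Localization.AtPrime.under_maximalIdeal
  have hP : P ≤ maximalIdeal R := Ideal.map_le_iff_le_comap.2 (hm.symm ▸ hpq)
  have : IsNoetherianRing R := IsLocalization.isNoetherianRing q.primeCompl R inferInstance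
  obtain ⟨rs, hrsP, hrs, Q, hQ, hPQ⟩ := exists_isWeaklyRegular_append_maximal (N := R) hP []
    (by simp) (IsWeaklyRegular.nil R R)
  rw [List.nil_append] at hrs hQ
  obtain ⟨ys, hys, hrsys, Q', hQ', hmQ'⟩ := exists_isWeaklyRegular_append_maximal (N := R) le_rfl rs
    (fun r hr ↦ hP (hrsP r hr)) hrs
  obtain rfl : Q' = maximalIdeal R := (le_maximalIdeal hQ'.isPrime.ne_top).antisymm hmQ'
  refine ⟨rs.length, ys.length, length_le_localRingDepth_of_le hpq hrs hrsP, ?_, ?_⟩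
  -- `φ` measures height in `A / p`. It is strictly increasing on primes above `pA_q`, because these
  -- are determined by their images in `A / p`, and its value at the maximal ideal is the height of
  -- `q / p`.
  · let φ : Ideal R → ℕ∞ := fun I ↦ ((I.comap (algebraMap A R)).map (Ideal.Quotient.mk p)).height
    have hker : ∀ I : Ideal R, P ≤ I → RingHom.ker (Ideal.Quotient.mk p) ≤
        I.comap (algebraMap A R) := fun I hI ↦ by
      rw [Ideal.mk_ker]
      exact Ideal.map_le_iff_le_comap.1 hI
    have hφ : ∀ I J : Ideal R, I.IsPrime → J.IsPrime → P ≤ I → I < J → φ I + 1 ≤ φ J := by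
      intro I J hI hJ hPI hIJ
      have h1 := Ideal.map_isPrime_of_surjective Ideal.Quotient.mk_surjective (hker I hPI)
      have h2 := Ideal.map_isPrime_of_surjective Ideal.Quotient.mk_surjective
        (hker J (hPI.trans hIJ.le))
      refine Ideal.height_add_one_le_of_lt_of_isPrime (lt_of_le_of_ne
        (Ideal.map_mono (Ideal.comap_mono hIJ.le)) fun h ↦ hIJ.ne ?_)
      have h3 := congrArg (Ideal.comap (Ideal.Quotient.mk p)) h
      rw [Ideal.comap_map_of_surjective' _ Ideal.Quotient.mk_surjective,
        Ideal.comap_map_of_surjective' _ Ideal.Quotient.mk_surjective,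
        sup_eq_left.2 (hker I hPI), sup_eq_left.2 (hker J (hPI.trans hIJ.le))] at h3
      rw [← IsLocalization.map_under q.primeCompl R I, ← IsLocalization.map_under q.primeCompl R J]
      exact congrArg (Ideal.map (algebraMap A R)) h3
    have h := add_length_le_of_isWeaklyRegular φ P hφ ys hys
      ((isWeaklyRegular_append_iff R rs ys).1 hrsys).2 hQ hPQ
    simp only [φ, hm] at h
    exact le_add_self.trans h
  · intro n N _ _
    -- The maximal ideal is associated to `R / (rs ++ ys)`; the element realizing it supplies the
    -- socle representative.
    obtain ⟨x, hx⟩ := hQ'.exists_mem_iff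
    obtain ⟨z, rfl⟩ := Submodule.Quotient.mk_surjective _ x
    have htop : (Ideal.ofList (rs ++ ys) • ⊤ : Submodule R R) = Ideal.ofList (rs ++ ys) := by
      rw [smul_eq_mul, Ideal.mul_top]
    have hz : ∀ a : R, a ∈ maximalIdeal R ↔ a * z ∈ Ideal.ofList (rs ++ ys) := fun a ↦ by
      rw [hx a, ← Submodule.Quotient.mk_smul, Submodule.Quotient.mk_eq_zero, htop, smul_eq_mul]
    rw [← List.length_append]
    refine hasProjectiveDimensionLE_length_of_maximal hrsys (z := z) (fun h ↦ ?_)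
      (fun a ha ↦ (hz a).1 ha) n N
    exact (Ideal.ne_top_iff_one _).1 (Ideal.IsPrime.ne_top inferInstance)
      ((hz 1).2 (by rwa [one_mul]))

/-- The prefix of a system of parameters of `A / p` lying in `q / p` lifts to a sequence in `q`
that is weakly regular on every balanced big Cohen-Macaulay module over `A / p`. -/
lemma exists_list_isWeaklyRegular_of_isBalancedBigCohenMacaulay {A : Type u} [CommRing A]
    [IsLocalRing A] [IsNoetherianRing A] {p q : Ideal A} [p.IsPrime] [q.IsPrime] (hpq : p ≤ q)
    {C : Type u} [AddCommGroup C] [Module A C] [Module (A ⧸ p) C] [IsScalarTower A (A ⧸ p) C]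
    (hC : IsBalancedBigCohenMacaulay (A ⧸ p) C) :
    ∃ xs : List A, (∀ x ∈ xs, x ∈ q) ∧
      (xs.length : ℕ∞) = (q.map (Ideal.Quotient.mk p)).height ∧ IsWeaklyRegular C xs := by
  have hker : RingHom.ker (Ideal.Quotient.mk p) ≤ q := by rwa [Ideal.mk_ker]
  have := Ideal.map_isPrime_of_surjective Ideal.Quotient.mk_surjective hker
  obtain ⟨xs', ys', hxs', hlen, hsop⟩ :=
    exists_isSystemOfParameters_append (q.map (Ideal.Quotient.mk p))
  obtain ⟨xs, rfl⟩ : ∃ xs : List A, xs.map (Ideal.Quotient.mk p) = xs' :=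
    List.map_surjective_iff.2 Ideal.Quotient.mk_surjective xs'
  refine ⟨xs, fun x hx ↦ ?_, by rwa [List.length_map] at hlen, ?_⟩
  · have h1 : x ∈ (q.map (Ideal.Quotient.mk p)).comap (Ideal.Quotient.mk p) :=
      hxs' _ (List.mem_map_of_mem hx)
    rwa [Ideal.comap_map_of_surjective' _ Ideal.Quotient.mk_surjective, sup_eq_left.2 hker] at h1
  · have h1 := ((isWeaklyRegular_append_iff C _ _).1 (hC.isRegular _ hsop).toIsWeaklyRegular).1
    exact (isWeaklyRegular_map_algebraMap_iff (A ⧸ p) C xs).1 h1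

/-- `Tor` is computed by the complex `X ⊗ P`, for `P` a projective resolution. -/
noncomputable def torIso {A : Type u} [CommRing A] (X M : ModuleCat.{u} A)
    (P : ProjectiveResolution M) (n : ℕ) :
    ((Tor (ModuleCat.{u} A) n).obj X).obj M ≅ ((tensorComplex P.complex).obj X).homology n :=
  P.isoLeftDerivedObj ((MonoidalCategory.tensoringLeft (ModuleCat.{u} A)).obj X) n

lemma exists_smul_homology_eq_zero {A : Type u} [CommRing A] [IsNoetherianRing A] (q : Ideal A)
    [q.IsPrime] (X M : ModuleCat.{u} A) (P : ProjectiveResolution M) [Module.Finite A M] (d : ℕ)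
    (hM : HasProjectiveDimensionLE (M.localizedModule q.primeCompl) d) (n : ℕ) (hn : d < n)
    (e : ((tensorComplex P.complex).obj X).homology n) : ∃ a ∉ q, a • e = 0 := by
  obtain ⟨a, haq, ha⟩ := exists_smul_tor_eq_zero q X d M hM n hn ((torIso X M P n).inv.hom e)
  refine ⟨a, haq, ?_⟩
  have h : (torIso X M P n).hom.hom ((torIso X M P n).inv.hom (a • e)) = a • e :=
    congr($((torIso X M P n).inv_hom_id).hom (a • e))
  rw [← h, map_smul, ha, map_zero]

end DepthAndTor

/-! ### The main theorem. -/

theorem theorem6 (A : Type u) [CommRing A] [IsLocalRing A] [IsNoetherianRing A]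
    (M : Type u) [AddCommGroup M] [Module A M] [Module.Finite A M]
    (hM : projectiveDimension (ModuleCat.of A M) ≠ ⊤)
    (p : Ideal A) [p.IsPrime]
    (C : Type u) [AddCommGroup C] [Module A C] [Module (A ⧸ p) C] [IsScalarTower A (A ⧸ p) C]
    (hC : IsBalancedBigCohenMacaulay (A ⧸ p) C) :
    torSup A C M ≤ ((localRingDepth (Localization.AtPrime p) : ℕ∞) : WithBot ℕ∞) := by
  classical
  obtain ⟨d, hd⟩ := (projectiveDimension_ne_top_iff _).1 hM
  let P := projectiveResolution (ModuleCat.of A M)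
  let K := (tensorComplex P.complex).obj (ModuleCat.of A C)
  have hpdloc : ∀ q : Ideal A, [q.IsPrime] →
      HasProjectiveDimensionLE ((ModuleCat.of A M).localizedModule q.primeCompl) d := fun q _ ↦
    ModuleCat.localizedModule_hasProjectiveDimensionLE d q.primeCompl (ModuleCat.of A M)
  -- At the maximal ideal, elements outside the prime are units, so annihilation becomes vanishing
  -- and a top degree `s` exists.
  have hvanish : ∀ i, d < i → Limits.IsZero (K.homology i) := by
    intro i hi
    have : Subsingleton (K.homology i) := subsingleton_of_forall_eq 0 fun e ↦ by
      obtain ⟨a, ha, hae⟩ := exists_smul_homology_eq_zero (IsLocalRing.maximalIdeal A)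
        (ModuleCat.of A C) (ModuleCat.of A M) P d (hpdloc _) i hi e
      have hu : IsUnit a := by simpa using ha
      exact (hu.smul_eq_zero).1 hae
    exact ModuleCat.isZero_of_subsingleton _
  refine iSup₂_le fun n hn ↦ ?_
  have hn' : ¬ Limits.IsZero (K.homology n) := fun h ↦
    hn (h.of_iso (torIso (ModuleCat.of A C) (ModuleCat.of A M) P n))
  have hnd : n ≤ d := not_lt.1 fun h ↦ hn' (hvanish n h)
  let s := Nat.findGreatest (fun i ↦ ¬ Limits.IsZero (K.homology i)) d
  have hns : n ≤ s := Nat.le_findGreatest hnd hn'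
  have hs : ¬ Limits.IsZero (K.homology s) :=
    Nat.findGreatest_spec (P := fun i ↦ ¬ Limits.IsZero (K.homology i)) hnd hn'
  have htop : ∀ i, s < i → Limits.IsZero (K.homology i) := by
    intro i hi
    by_contra h
    rcases le_or_gt i d with h1 | h1
    · exact Nat.findGreatest_is_greatest hi h1 h
    · exact h (hvanish i h1)
  have : Nontrivial (K.homology s) := by
    by_contra h
    rw [not_nontrivial_iff_subsingleton] at h
    exact hs (ModuleCat.isZero_of_subsingleton _)
  obtain ⟨q, hq⟩ := associatedPrimes.nonempty A (K.homology s)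
  have := hq.isPrime
  obtain ⟨e, he⟩ := hq.exists_mem_iff
  have hpq : p ≤ q := fun a ha ↦ (he a).2 <|
    smul_eq_zero_of_mem_annihilator P.complex (ModuleCat.of A C) (fun c ↦ by
      change a • c = 0
      rw [← one_smul (A ⧸ p) c, ← smul_assoc, ← Algebra.algebraMap_eq_smul_one,
        Ideal.Quotient.algebraMap_eq, Ideal.Quotient.eq_zero_iff_mem.2 ha, zero_smul]) s e
  obtain ⟨xs, hxq, hxlen, hxreg⟩ :=
    exists_list_isWeaklyRegular_of_isBalancedBigCohenMacaulay hpq hC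
  obtain ⟨X, e', he'⟩ := exists_homology_of_isWeaklyRegular P.complex xs (ModuleCat.of A C) hxreg s
    htop e fun x hx ↦ (he x).1 (hxq x hx)
  obtain ⟨t, l, ht, hl, hpd⟩ := exists_hasProjectiveDimensionLE_add hpq
  rw [← hxlen] at hl
  have hl' : l ≤ xs.length := by exact_mod_cast hl
  have : IsLocalizedModule q.primeCompl
      ((ModuleCat.of A M).localizedModuleMkLinearMap q.primeCompl) :=
    ModuleCat.localizedModule_isLocalizedModule _ _
  have hfin : Module.Finite (Localization.AtPrime q)
      ((ModuleCat.of A M).localizedModule q.primeCompl) :=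
    Module.Finite.of_isLocalizedModule q.primeCompl
      ((ModuleCat.of A M).localizedModuleMkLinearMap q.primeCompl)
  -- Otherwise an element outside `q` would kill `e'`, whose annihilator is `q`.
  have hle : s + xs.length ≤ t + l := by
    by_contra! hlt
    have := hpdloc q
    obtain ⟨a, haq, ha⟩ := exists_smul_homology_eq_zero q X (ModuleCat.of A M) P (t + l)
      (hpd d _) _ hlt e'
    exact haq ((he a).2 ((he' a).1 ha))
  have hst : n ≤ t := by omega
  exact WithBot.coe_le_coe.2 (le_trans (by exact_mod_cast hst) ht)
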